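/- **Setting.** $M$ players are to be assigned to $K=2$ arms with means $\mu=(\mu_1,\mu_2)\in[0,1]^2$ for $T$ rounds. At each round $t$ a central entity chooses a (possibly random) assignment $\mathbf M(t)=(M_1(t),M_2(t))$ in the set $\mathcal M$ of all $(m_1,m_2)\in\{0,\dots,M\}^2$ with $m_1+m_2=M$ and $m_k\le -1/\log(1-p)$. Each player is then active, independently, with probability $p$. With $\eta_k=1$ if exactly one player is active on arm $k$ and $\eta_k=0$ otherwise, arm $k$ yields the reward $\eta_kX_k$, where $X_k$ is Bernoulli with mean $\mu_k$; all activations and all $X_k$, over arms and rounds, are independent. After the round the central entity observes, for each arm, the number of active players on it (hence $\eta_k$) and the reward $\eta_kX_k$. An algorithm chooses the law of $\mathbf M(t)$ as an arbitrary function of all past assignments and observations; it may use $M$, $p$ and $T$. Its expected regret is $$\mathbb E[R]=T\max_{m\in\mathcal M}\mathbb E\Big[\sum_{k}\eta_k(m_k)X_k\Big]-\sum_{t=1}^T\mathbb E\Big[\sum_k\eta_k(M_k(t))X_k\Big].$$ Let $g(n)=np(1-p)^{n-1}$, so that $\mathbb E[\eta_k(n)X_k]=\mu_k\,g(n)$,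 and let $\langle\mu,g(m)\rangle=\sum_k\mu_k\,g(m_k)$. Let $\nu^*(\mu)$ be the number of arms without players in a maximizer of $\langle\mu,g(m)\rangle$ over $\mathcal M$ (the largest such number, if there are several maximizers). Let $\mathcal M_\nu$ be the set of $m\in\mathcal M$ with at most $\nu$ zero entries, let $r_\nu(\mu)$ be the infimum of $\|\mu'-\mu\|_\infty$ over those $\mu'\in\mathbb R^2$ for which some maximizer of $\langle\mu',g(m)\rangle$ over $\mathcal M_\nu$ differs from some maximizer of $\langle\mu,g(m)\rangle$ over $\mathcal M_\nu$, and let $r(\mu)=\min_{0\le\nu\le\nu^*(\mu)}r_\nu(\mu)$. **Lemma (lower bound for $\nu^*=0$).** Let $K=2$ and $M=2N+1$ with an integer $N\ge1$, let $p\in[0,1]$ with $p\le\frac1{M+1}$, let $0<r_0<\frac p{12}$, and let $T$ be an integer with $T\ge\frac1{16\,g(M)\,r_0^2}$. Then for every algorithm there are arm means $\mu\in[0,1]^2$ with $\nu^*(\mu)=0$ and $r(\mu)=r_0$ such that the expected regret of the algorithm over $T$ rounds on the means $\mu$ satisfies $$\mathbb E[R]\ \ge\ \frac1{256\,M\,r_0}.$$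 -/

import Mathlib

namespace AMMAB

noncomputable section

open ProbabilityTheory

/-- `g(n) = n p (1 - p)^(n-1)`. -/
def g (p : ℝ) (n : ℕ) : ℝ := n * p * (1 - p) ^ (n - 1)

/-- Valid assignments of `M` players to `K` arms: the entry `m k` is the number of players
on arm `k`; the entries sum to `M` and each is at most `-1 / log (1 - p)`. -/
abbrev Assignment (M K : ℕ) (p : ℝ) : Type :=
  {m : Fin K → Fin (M + 1) //
    ∑ k, (m k : ℕ) = M ∧ ∀ k, ((m k : ℕ) : ℝ) ≤ -1 / Real.log (1 - p)}

instance instFintypeAssignment (M K : ℕ) (p : ℝ) : Fintype (Assignment M K p) :=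
  Fintype.ofFinite _

/-- What the central entity observes in one round: for each arm, the number of active players
on it, and the reward earned on it (the Boolean `true` is reward `1`, `false` is reward `0`). -/
abbrev Observation (M K : ℕ) : Type := Fin K → Fin (M + 1) × Bool

/-- The joint law of independent random variables indexed by `Fin K`, with laws `P k`. -/
def indepPMF {K : ℕ} {α : Type} [Fintype α] (P : Fin K → PMF α) : PMF (Fin K → α) :=
  PMF.ofFintype (fun y => ∏ k, P k (y k)) (by
    classical
    rw [← Fintype.prod_sum (fun k a => P k a)]
    refine Finset.prod_eq_one fun k _ => ?_
    exact (tsum_fintype (fun a => P k a)).symm.trans (P k).tsum_coe)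

/-- The law of the observation on one arm of mean `μ` to which `n ≤ M` players are assigned.
Each player is independently active with probability `p`, so the number `a` of active players
is binomial; `X` is Bernoulli with mean `μ`, independent of `a`; the arm yields the reward
`η X`, where `η` is the indicator of `a = 1`. (As `a ≤ n ≤ M`, `Fin.ofNat (M + 1) a` is `a`.) -/
def armLaw (M : ℕ) (p μ : unitInterval) (n : ℕ) : PMF (Fin (M + 1) × Bool) :=
  (binomial n p).toPMF.bind fun a =>
    (bernoulliMeasure true false μ).toPMF.map fun X =>
      (Fin.ofNat (M + 1) a, decide (a = 1) && X)

/-- The law of the observation of one round under the assignment `m`: arms are independent. -/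
def obsLaw {M K : ℕ} (p : unitInterval) (μ : Fin K → unitInterval) (m : Assignment M K p) :
    PMF (Observation M K) :=
  indepPMF fun k => armLaw M p (μ k) (m.1 k)

/-- One round of play: the chosen assignment and the observation made. -/
abbrev Round (M K : ℕ) (p : ℝ) : Type := Assignment M K p × Observation M K

/-- A (randomized, centralized) algorithm: given the first `t` rounds, the law of the assignment
chosen in the next one. -/
abbrev Algorithm (M K : ℕ) (p : ℝ) : Type :=
  (t : ℕ) → (Fin t → Round M K p) → PMF (Assignment M K p)

/-- The law of the first `t` rounds when the algorithm `A` faces the arm means `μ`. -/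
def historyLaw {M K : ℕ} (p : unitInterval) (μ : Fin K → unitInterval) (A : Algorithm M K p) :
    (t : ℕ) → PMF (Fin t → Round M K p)
  | 0 => PMF.pure Fin.elim0
  | t + 1 => (historyLaw p μ A t).bind fun h => (A t h).bind fun m =>
      (obsLaw p μ m).map fun o => Fin.snoc (α := fun _ => Round M K p) h (m, o)

/-- The total reward `∑ k, η_k X_k` earned in one round. -/
def reward {M K : ℕ} (o : Observation M K) : ℝ := ∑ k, if (o k).2 then 1 else 0

/-- `E[∑ k, η_k(m_k) X_k]`, the expected total reward of a round played with assignment `m`. -/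
def meanReward {M K : ℕ} (p : unitInterval) (μ : Fin K → unitInterval)
    (m : Assignment M K p) : ℝ :=
  ∑ o, (obsLaw p μ m o).toReal * reward o

/-- The expected regret of `A` over `T` rounds: `T` times the largest expected reward of a valid
assignment, minus the expected reward earned by `A`. -/
def expectedRegret {M K : ℕ} (p : unitInterval) (μ : Fin K → unitInterval)
    (A : Algorithm M K p) (T : ℕ) : ℝ :=
  T * (⨆ m : Assignment M K p, meanReward p μ m) -
    ∑ h, (historyLaw p μ A T h).toReal * ∑ t, reward (h t).2

/-- `⟨μ, g(m)⟩`. -/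
def value {M K : ℕ} {p : ℝ} (μ : Fin K → ℝ) (m : Assignment M K p) : ℝ :=
  ∑ k, μ k * g p (m.1 k)

/-- The set of maximizers of `⟨μ, g(m)⟩` over `m ∈ S`. -/
def maximizers {M K : ℕ} {p : ℝ} (S : Set (Assignment M K p)) (μ : Fin K → ℝ) :
    Set (Assignment M K p) :=
  {m | m ∈ S ∧ ∀ m' ∈ S, value μ m' ≤ value μ m}

/-- The number of arms to which `m` assigns no player. -/
def emptyArms {M K : ℕ} {p : ℝ} (m : Assignment M K p) : ℕ :=
  (Finset.univ.filter fun k => (m.1 k : ℕ) = 0).card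

/-- The valid assignments that leave at most `ν` arms without players
(equivalently, whose support has at least `K - ν` elements). -/
def atMostEmpty (M K : ℕ) (p : ℝ) (ν : ℕ) : Set (Assignment M K p) :=
  {m | emptyArms m ≤ ν}

/-- `ν*`: the number of arms without players in an optimal assignment
(the largest such number, if there are several optimal assignments). -/
def nuStar (M : ℕ) {K : ℕ} (p : ℝ) (μ : Fin K → ℝ) : ℕ :=
  sSup {n | ∃ m ∈ maximizers (Set.univ : Set (Assignment M K p)) μ, n = emptyArms m}

/-- `r_ν`: the least sup-norm distance from `μ` to some `μ'` for which an optimal assignment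
among those with at most `ν` empty arms differs from the one for `μ`. -/
def rNu (M : ℕ) {K : ℕ} (p : ℝ) (μ : Fin K → ℝ) (ν : ℕ) : ℝ :=
  sInf {d | ∃ m ∈ maximizers (atMostEmpty M K p ν) μ,
    ∃ μ' : Fin K → ℝ, ∃ m' ∈ maximizers (atMostEmpty M K p ν) μ', m' ≠ m ∧ d = ‖μ' - μ‖}

/-- `r(μ)`, the minimum of `r_ν` over `0 ≤ ν ≤ ν*`. -/
def r (M : ℕ) {K : ℕ} (p : ℝ) (μ : Fin K → ℝ) : ℝ :=
  ⨅ ν : Fin (nuStar M p μ + 1), rNu M p μ ν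

end

end AMMAB

/-!
The regret is bounded below by the two-point method. The two instances are the means
`1/2 + r₀` on arm `i` and `1/2 - r₀` on the other arm, for `i = 0` and `i = 1` (`hardMeans`).

*Geometry.* As `p ≤ 1 / (M + 1)`, every assignment is valid and `g` is increasing and strictly
concave on `{0, …, M}`, so the value of an assignment is unimodal in the number of players on
arm `i`. If the mean of arm `i` is larger than that of the other arm and both are within `p / 6`
of `1/2`, the unique optimum puts `N + 1` players on arm `i` and `N` on the other one
(`maximizers_eq_majority`): the imbalance is too small to pay for one more move. All means at
distance less than `r₀ < p / 12` from the instance are of this kind, while at `(1/2, 1/2)`, at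
distance exactly `r₀`, the mirror image of the optimum ties with it. Hence `ν* = 0` and `r = r₀`
(`nuStar_hardMeans`, `r_hardMeans`).

*Regret.* Every assignment puts at most `N` players on one of the arms, and so it loses at least
`Δ = 2 r₀ (g (N + 1) - g N)` in one of the two instances (`le_gap_add_gap`). Therefore the sum of
the two regrets is at least `Δ ∑ₜ ∑ₕ min (Pₜ h) (P'ₜ h)`, where `Pₜ` and `P'ₜ` are the laws of the
first `t` rounds (`le_expectedRegret_add`), and the overlap of two laws is at least half the square
of their Hellinger affinity (`affinity_sq_le`).

*Information.* Affinity multiplies over independent arms and, as a lower bound, over adaptively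
chosen rounds (`pow_le_affinity_historyLaw`). An arm with `n` players reveals its mean only with
probability `g n`, and the numbers of players on the two arms sum to `M`, so one round has
affinity at least `1 - a` with `a = (8/3) M p r₀²` (`affinity_obsLaw_hardInstance`).
The squared affinity after `t` rounds is at least `1 - 2 t a`; summing this over the first
`⌈1 / (16 g(M) r₀²)⌉ ≤ T` rounds, and using that `g (M) / M`, `p` and `g (N + 1) - g N` agree up
to constants, bounds the sum of the two regrets below by `2 / (256 M r₀)`.
-/

namespace AMMAB

noncomputable section

open ProbabilityTheory

/-! ### Affinity of discrete laws -/

/-- The Bhattacharyya coefficient (Hellinger affinity) `∑ √(P Q)` of two laws on a finite type. -/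
def affinity {α : Type*} [Fintype α] (P Q : PMF α) : ℝ :=
  ∑ a, √((P a).toReal * (Q a).toReal)

lemma sum_toReal {α : Type*} [Fintype α] (P : PMF α) : ∑ a, (P a).toReal = 1 := by
  have h := P.tsum_coe
  rw [tsum_fintype] at h
  rw [← ENNReal.toReal_sum fun a _ => P.apply_ne_top a, h, ENNReal.toReal_one]

/-- Le Cam's inequality: the overlap `∑ min(P, Q)`, which is one minus the total variation
distance, is at least half the squared affinity. -/
lemma affinity_sq_le {α : Type*} [Fintype α] (P Q : PMF α) :
    affinity P Q ^ 2 ≤ 2 * ∑ a, min (P a).toReal (Q a).toReal := by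
  -- Cauchy-Schwarz, after splitting `P Q` into the product of its minimum and its maximum.
  have h1 : affinity P Q
      = ∑ a, √(min (P a).toReal (Q a).toReal) * √(max (P a).toReal (Q a).toReal) := by
    refine Finset.sum_congr rfl fun a _ => ?_
    rw [← Real.sqrt_mul (le_min ENNReal.toReal_nonneg ENNReal.toReal_nonneg), min_mul_max]
  have h2 : ∑ a, max (P a).toReal (Q a).toReal ≤ 2 := by
    calc ∑ a, max (P a).toReal (Q a).toReal ≤ ∑ a, ((P a).toReal + (Q a).toReal) :=
          Finset.sum_le_sum fun a _ =>
            max_le_add_of_nonneg ENNReal.toReal_nonneg ENNReal.toReal_nonneg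
      _ = 2 := by rw [Finset.sum_add_distrib, sum_toReal, sum_toReal]; norm_num
  have h0 : ∀ a, 0 ≤ min (P a).toReal (Q a).toReal := fun a =>
    le_min ENNReal.toReal_nonneg ENNReal.toReal_nonneg
  have h0' : ∀ a, 0 ≤ max (P a).toReal (Q a).toReal := fun a =>
    le_max_of_le_left ENNReal.toReal_nonneg
  rw [h1]
  refine (Finset.sum_mul_sq_le_sq_mul_sq _ _ _).trans ?_
  simp only [Real.sq_sqrt (h0 _), Real.sq_sqrt (h0' _)]
  rw [mul_comm 2]
  exact mul_le_mul_of_nonneg_left h2 (Finset.sum_nonneg fun a _ => h0 a)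

/-! ### The law of one round -/

lemma indepPMF_toReal {K : ℕ} {α : Type} [Fintype α] (P : Fin K → PMF α) (y : Fin K → α) :
    (indepPMF P y).toReal = ∏ k, (P k (y k)).toReal := by
  simp [indepPMF, ENNReal.toReal_prod]

/-- Affinity is multiplicative over independent coordinates. -/
lemma affinity_indepPMF {K : ℕ} {α : Type} [Fintype α] (P Q : Fin K → PMF α) :
    affinity (indepPMF P) (indepPMF Q) = ∏ k, affinity (P k) (Q k) := by
  classical
  unfold affinity
  rw [Fintype.prod_sum]
  refine Finset.sum_congr rfl fun y _ => ?_
  rw [indepPMF_toReal, indepPMF_toReal, ← Finset.prod_mul_distrib,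
    Real.sqrt_prod]
  exact fun k _ => mul_nonneg ENNReal.toReal_nonneg ENNReal.toReal_nonneg

lemma sum_indepPMF_mul {K : ℕ} {α : Type} [Fintype α] (P : Fin K → PMF α) (j : Fin K)
    (f : α → ℝ) :
    ∑ y, (indepPMF P y).toReal * f (y j) = ∑ a, (P j a).toReal * f a := by
  classical
  -- Expand `∏ k, ∑ a, P k a * φ k a`, where `φ j = f` and `φ k = 1` for `k ≠ j`.
  have h := Fintype.prod_sum (fun (k : Fin K) (a : α) =>
    (P k a).toReal * if k = j then f a else 1)
  rw [Finset.prod_eq_single j] at h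
  · simp only [if_true] at h
    rw [h]
    refine Finset.sum_congr rfl fun y _ => ?_
    rw [indepPMF_toReal, Finset.prod_mul_distrib]
    simp
  · intro k _ hk
    simp [hk, sum_toReal]
  · simp

/-- Explicit probabilities of the observation on one arm. The bound `n ≤ M` makes the reduction
modulo `M + 1` in `armLaw` harmless. -/
lemma armLaw_toReal {M n : ℕ} (hn : n ≤ M) (p μ : unitInterval) (b : Fin (M + 1)) (x : Bool) :
    (armLaw M p μ n (b, x)).toReal = (n.choose b * (p : ℝ) ^ (b : ℕ) * (1 - p) ^ (n - b)) *
      (if (b : ℕ) = 1 then (if x then (μ : ℝ) else 1 - μ) else if x then 0 else 1) := by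
  have hb : ∀ a : ℕ, a ≤ M → Fin.ofNat (M + 1) a = b → a = b := by
    rintro a ha rfl
    simp [Nat.mod_eq_of_lt (Nat.lt_succ_of_le ha)]
  rw [armLaw, PMF.bind_apply, tsum_eq_single (b : ℕ)]
  · rw [ENNReal.toReal_mul, MeasureTheory.Measure.toPMF_apply, ← MeasureTheory.measureReal_def,
      binomial_real_singleton, PMF.map_apply, tsum_fintype]
    congr 1
    simp only [Fintype.sum_bool, Prod.mk.injEq, Fin.ofNat_val_eq_self,
      MeasureTheory.Measure.toPMF_apply, true_and]
    by_cases h1 : (b : ℕ) = 1 <;> cases x <;> simp [h1]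
    rw [ENNReal.toReal_add ENNReal.coe_ne_top ENNReal.coe_ne_top]
    simp
  · intro a ha
    by_cases haM : a ≤ M
    · rw [PMF.map_apply, mul_eq_zero]
      right
      rw [ENNReal.tsum_eq_zero]
      intro X
      rw [if_neg]
      intro h
      exact ha (hb a haM (Prod.ext_iff.1 h).1.symm)
    · rw [MeasureTheory.Measure.toPMF_apply, binomial_singleton,
        Nat.choose_eq_zero_of_lt (by omega)]
      simp

lemma armLaw_true_toReal {M n : ℕ} (hM : 1 ≤ M) (hn : n ≤ M) (p μ : unitInterval)
    (b : Fin (M + 1)) :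
    (armLaw M p μ n (b, true)).toReal = if b = ⟨1, by omega⟩ then μ * g p n else 0 := by
  rw [armLaw_toReal hn]
  by_cases h : (b : ℕ) = 1
  · simp [h, Fin.ext_iff, g, mul_comm]
  · simp [h, Fin.ext_iff]

lemma sum_armLaw_reward {M n : ℕ} (hM : 1 ≤ M) (hn : n ≤ M) (p μ : unitInterval) :
    ∑ y, (armLaw M p μ n y).toReal * (if y.2 then 1 else 0) = μ * g p n := by
  rw [Fintype.sum_prod_type]
  simp [armLaw_true_toReal hM hn]

lemma meanReward_eq_value {M K : ℕ} (hM : 1 ≤ M) (p : unitInterval) (μ : Fin K → unitInterval)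
    (m : Assignment M K p) : meanReward p μ m = value (fun k => (μ k : ℝ)) m := by
  unfold meanReward reward value obsLaw
  simp_rw [Finset.mul_sum]
  rw [Finset.sum_comm]
  refine Finset.sum_congr rfl fun k _ => ?_
  rw [sum_indepPMF_mul (fun k => armLaw M p (μ k) (m.1 k)) k (fun y => if y.2 then (1 : ℝ) else 0)]
  exact sum_armLaw_reward hM (Nat.lt_succ_iff.1 (m.1 k).2) p (μ k)

lemma g_nonneg (p : unitInterval) (n : ℕ) : 0 ≤ g p n :=
  mul_nonneg (mul_nonneg n.cast_nonneg p.2.1) (pow_nonneg (sub_nonneg.2 p.2.2) _)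

lemma g_le (p : unitInterval) (n : ℕ) : g p n ≤ n * p :=
  mul_le_of_le_one_right (mul_nonneg n.cast_nonneg p.2.1)
    (pow_le_one₀ (sub_nonneg.2 p.2.2) (sub_le_self _ p.2.1))

/-- The observation on one arm carries information on its mean only if `η = 1`. -/
lemma affinity_armLaw {M n : ℕ} (hM : 1 ≤ M) (hn : n ≤ M) (p μ μ' : unitInterval) :
    affinity (armLaw M p μ n) (armLaw M p μ' n)
      = 1 - g p n * (1 - (√((μ : ℝ) * μ') + √((1 - μ) * (1 - μ')))) := by
  have hs := sum_toReal (armLaw M p μ n)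
  unfold affinity
  rw [Fintype.sum_prod_type] at hs ⊢
  let one : Fin (M + 1) := ⟨1, by omega⟩
  rw [← Finset.add_sum_erase _ _ (Finset.mem_univ one)] at hs ⊢
  -- The outcomes with `η = 0` have the same probability for both means.
  have hrest : ∑ b ∈ Finset.univ.erase one, ∑ x, √((armLaw M p μ n (b, x)).toReal *
        (armLaw M p μ' n (b, x)).toReal)
      = ∑ b ∈ Finset.univ.erase one, ∑ x, (armLaw M p μ n (b, x)).toReal := by
    refine Finset.sum_congr rfl fun b hb => Finset.sum_congr rfl fun x _ => ?_
    have hb1 : (b : ℕ) ≠ 1 := fun h => (Finset.mem_erase.1 hb).1 (Fin.ext h)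
    have : (armLaw M p μ' n (b, x)).toReal = (armLaw M p μ n (b, x)).toReal := by
      rw [armLaw_toReal hn, armLaw_toReal hn, if_neg hb1, if_neg hb1]
    rw [this, Real.sqrt_mul_self ENNReal.toReal_nonneg]
  have ht : ∀ ν : unitInterval, (armLaw M p ν n (one, true)).toReal = g p n * ν := fun ν => by
    rw [armLaw_toReal hn]; simp [one, g]
  have hf : ∀ ν : unitInterval, (armLaw M p ν n (one, false)).toReal = g p n * (1 - ν) :=
    fun ν => by rw [armLaw_toReal hn]; simp [one, g]
  have hsq : ∀ x y : ℝ, √(g p n * x * (g p n * y)) = g p n * √(x * y) := fun x y => by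
    rw [show g p n * x * (g p n * y) = g p n ^ 2 * (x * y) by ring,
      Real.sqrt_mul (sq_nonneg _), Real.sqrt_sq (g_nonneg p n)]
  rw [hrest]
  simp only [Fintype.sum_bool, ht, hf, hsq] at hs ⊢
  linarith

/-! ### The law of the history -/

/-- A sum over histories of `t + 1` rounds, split by the last round. -/
lemma sum_history_succ {M K : ℕ} {p : ℝ} (t : ℕ) (F : (Fin (t + 1) → Round M K p) → ℝ) :
    ∑ h, F h = ∑ h : Fin t → Round M K p, ∑ m, ∑ o,
      F (Fin.snoc (α := fun _ => Round M K p) h (m, o)) := by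
  rw [← (Fin.snocEquiv fun _ : Fin (t + 1) => Round M K p).sum_comp, Fintype.sum_prod_type,
    Finset.sum_comm]
  refine Finset.sum_congr rfl fun h _ => ?_
  rw [Fintype.sum_prod_type]
  rfl

lemma historyLaw_succ_toReal {M K : ℕ} (p : unitInterval) (μ : Fin K → unitInterval)
    (A : Algorithm M K p) (t : ℕ) (h : Fin t → Round M K p) (m : Assignment M K p)
    (o : Observation M K) :
    (historyLaw p μ A (t + 1) (Fin.snoc (α := fun _ => Round M K p) h (m, o))).toReal
      = (historyLaw p μ A t h).toReal * ((A t h m).toReal * (obsLaw p μ m o).toReal) := by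
  have hinj : ∀ h' m' o', Fin.snoc (α := fun _ => Round M K p) h (m, o)
      = Fin.snoc (α := fun _ => Round M K p) h' (m', o') → h = h' ∧ m = m' ∧ o = o' := by
    intro h' m' o' he
    have he' := Fin.snoc_injective2 he
    simpa using he'
  rw [historyLaw, PMF.bind_apply, tsum_eq_single h, PMF.bind_apply, tsum_eq_single m,
    PMF.map_apply, tsum_eq_single o, if_pos rfl, ENNReal.toReal_mul, ENNReal.toReal_mul]
  · intro o' ho'
    exact if_neg fun he => ho' (hinj _ _ _ he).2.2.symm
  · intro m' hm'
    rw [PMF.map_apply, mul_eq_zero]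
    right
    rw [ENNReal.tsum_eq_zero]
    exact fun o' => if_neg fun he => hm' (hinj _ _ _ he).2.1.symm
  · intro h' hh'
    rw [PMF.bind_apply, mul_eq_zero]
    right
    rw [ENNReal.tsum_eq_zero]
    intro m'
    rw [PMF.map_apply, mul_eq_zero]
    right
    rw [ENNReal.tsum_eq_zero]
    exact fun o' => if_neg fun he => hh' (hinj _ _ _ he).1.symm

/-- If every single round has affinity at least `b`, then `t` adaptively chosen rounds have
affinity at least `b ^ t`. -/
lemma pow_le_affinity_historyLaw {M K : ℕ} (p : unitInterval) (μ μ' : Fin K → unitInterval)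
    (A : Algorithm M K p) {b : ℝ} (hb : 0 ≤ b)
    (h : ∀ m : Assignment M K p, b ≤ affinity (obsLaw p μ m) (obsLaw p μ' m)) (t : ℕ) :
    b ^ t ≤ affinity (historyLaw p μ A t) (historyLaw p μ' A t) := by
  induction t with
  | zero => simp [affinity, historyLaw, Subsingleton.elim _ (Fin.elim0 : Fin 0 → Round M K p)]
  | succ t ih =>
    calc b ^ (t + 1) ≤ affinity (historyLaw p μ A t) (historyLaw p μ' A t) * b := by
          rw [pow_succ]; exact mul_le_mul_of_nonneg_right ih hb
      _ ≤ affinity (historyLaw p μ A (t + 1)) (historyLaw p μ' A (t + 1)) := by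
        unfold affinity
        rw [sum_history_succ, Finset.sum_mul]
        refine Finset.sum_le_sum fun hh _ => ?_
        have e : ∀ m o, √((historyLaw p μ A (t + 1)
              (Fin.snoc (α := fun _ => Round M K p) hh (m, o))).toReal *
            (historyLaw p μ' A (t + 1)
              (Fin.snoc (α := fun _ => Round M K p) hh (m, o))).toReal)
            = √((historyLaw p μ A t hh).toReal * (historyLaw p μ' A t hh).toReal) *
              ((A t hh m).toReal * √((obsLaw p μ m o).toReal * (obsLaw p μ' m o).toReal)) := by
          intro m o
          rw [historyLaw_succ_toReal, historyLaw_succ_toReal]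
          generalize hx : (historyLaw p μ A t hh).toReal = x
          generalize hy : (historyLaw p μ' A t hh).toReal = y
          have hx0 : 0 ≤ x := hx ▸ ENNReal.toReal_nonneg
          have hy0 : 0 ≤ y := hy ▸ ENNReal.toReal_nonneg
          rw [show ∀ a u v : ℝ, x * (a * u) * (y * (a * v)) = (x * y) * (a ^ 2 * (u * v)) from
            fun a u v => by ring, Real.sqrt_mul (mul_nonneg hx0 hy0), Real.sqrt_mul (sq_nonneg _),
            Real.sqrt_sq ENNReal.toReal_nonneg]
        simp_rw [e, ← Finset.mul_sum]
        refine mul_le_mul_of_nonneg_left ?_ (Real.sqrt_nonneg _)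
        calc b = ∑ m, (A t hh m).toReal * b := by rw [← Finset.sum_mul, sum_toReal, one_mul]
          _ ≤ _ := Finset.sum_le_sum fun m _ =>
            mul_le_mul_of_nonneg_left (h m) ENNReal.toReal_nonneg

/-! ### Regret -/

/-- The expected loss of an assignment in one round. -/
def gap {M K : ℕ} (p : unitInterval) (μ : Fin K → unitInterval) (m : Assignment M K p) : ℝ :=
  (⨆ m' : Assignment M K p, meanReward p μ m') - meanReward p μ m

lemma gap_nonneg {M K : ℕ} (p : unitInterval) (μ : Fin K → unitInterval)
    (m : Assignment M K p) : 0 ≤ gap p μ m :=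
  sub_nonneg.2 (le_ciSup (Set.finite_range (meanReward p μ)).bddAbove m)

/-- The regret is the sum over the rounds of the expected gap of the chosen assignment. -/
lemma expectedRegret_eq_sum {M K : ℕ} (p : unitInterval) (μ : Fin K → unitInterval)
    (A : Algorithm M K p) (T : ℕ) :
    expectedRegret p μ A T = ∑ t ∈ Finset.range T, ∑ h, (historyLaw p μ A t h).toReal *
      ∑ m, (A t h m).toReal * gap p μ m := by
  induction T with
  | zero => simp [expectedRegret]
  | succ t ih =>
    rw [Finset.sum_range_succ, ← ih]
    unfold expectedRegret
    have e : ∑ h, (historyLaw p μ A (t + 1) h).toReal * ∑ s, reward (h s).2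
        = ∑ h, (historyLaw p μ A t h).toReal * ∑ s, reward (h s).2
          + ∑ h, (historyLaw p μ A t h).toReal * ∑ m, (A t h m).toReal * meanReward p μ m := by
      rw [sum_history_succ, ← Finset.sum_add_distrib]
      refine Finset.sum_congr rfl fun h _ => ?_
      have ho : ∀ (S : ℝ) (m : Assignment M K p),
          ∑ o, (obsLaw p μ m o).toReal * (S + reward o) = S + meanReward p μ m := fun S m => by
        simp_rw [mul_add, Finset.sum_add_distrib, ← Finset.sum_mul, sum_toReal, one_mul]
        rfl
      have hm : ∀ S : ℝ, ∑ m, (A t h m).toReal * (S + meanReward p μ m)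
          = S + ∑ m, (A t h m).toReal * meanReward p μ m := fun S => by
        simp_rw [mul_add, Finset.sum_add_distrib, ← Finset.sum_mul, sum_toReal, one_mul]
      simp_rw [historyLaw_succ_toReal, Fin.sum_univ_castSucc, Fin.snoc_castSucc, Fin.snoc_last,
        mul_assoc, ← Finset.mul_sum, ho, hm, mul_add]
    have e2 : ∑ h, (historyLaw p μ A t h).toReal * ∑ m, (A t h m).toReal * gap p μ m
        = (⨆ m' : Assignment M K p, meanReward p μ m')
          - ∑ h, (historyLaw p μ A t h).toReal * ∑ m, (A t h m).toReal * meanReward p μ m := by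
      simp_rw [gap, mul_sub, Finset.sum_sub_distrib, ← Finset.sum_mul, sum_toReal, one_mul,
        mul_sub, Finset.sum_sub_distrib, ← Finset.sum_mul, sum_toReal, one_mul]
    rw [e, e2]
    push_cast
    ring

/-- Two-point lower bound: if no assignment is good for both `μ` and `μ'`, the regrets cannot
both be small in the rounds in which the histories are hard to tell apart. -/
lemma le_expectedRegret_add {M K : ℕ} (p : unitInterval) (μ μ' : Fin K → unitInterval)
    (A : Algorithm M K p) {Δ : ℝ} (hΔ : ∀ m : Assignment M K p, Δ ≤ gap p μ m + gap p μ' m) (hΔ0 : 0 ≤ Δ)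
    {τ T : ℕ} (hτ : τ ≤ T) :
    Δ / 2 * ∑ t ∈ Finset.range τ, affinity (historyLaw p μ A t) (historyLaw p μ' A t) ^ 2
      ≤ expectedRegret p μ A T + expectedRegret p μ' A T := by
  rw [expectedRegret_eq_sum, expectedRegret_eq_sum, ← Finset.sum_add_distrib, Finset.mul_sum]
  have hnn : ∀ (ν : Fin K → unitInterval) (t : ℕ) (h : Fin t → Round M K p),
      0 ≤ ∑ m, (A t h m).toReal * gap p ν m := fun ν t h =>
    Finset.sum_nonneg fun m _ => mul_nonneg ENNReal.toReal_nonneg (gap_nonneg p ν m)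
  have hnn' : ∀ (ν : Fin K → unitInterval) (t : ℕ), 0 ≤ ∑ h, (historyLaw p ν A t h).toReal *
      ∑ m, (A t h m).toReal * gap p ν m := fun ν t =>
    Finset.sum_nonneg fun h _ => mul_nonneg ENNReal.toReal_nonneg (hnn ν t h)
  refine le_trans (Finset.sum_le_sum fun t _ => ?_)
    (Finset.sum_le_sum_of_subset_of_nonneg (Finset.range_mono hτ) fun t _ _ =>
      add_nonneg (hnn' μ t) (hnn' μ' t))
  calc Δ / 2 * affinity (historyLaw p μ A t) (historyLaw p μ' A t) ^ 2
      ≤ Δ / 2 * (2 * ∑ h, min (historyLaw p μ A t h).toReal (historyLaw p μ' A t h).toReal) :=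
        mul_le_mul_of_nonneg_left (affinity_sq_le _ _) (by linarith)
    _ = ∑ h, min (historyLaw p μ A t h).toReal (historyLaw p μ' A t h).toReal * Δ := by
        rw [← Finset.sum_mul]; ring
    _ ≤ _ := by
        rw [← Finset.sum_add_distrib]
        refine Finset.sum_le_sum fun h _ => ?_
        have hmin : 0 ≤ min (historyLaw p μ A t h).toReal (historyLaw p μ' A t h).toReal :=
          le_min ENNReal.toReal_nonneg ENNReal.toReal_nonneg
        have hs : Δ ≤ ∑ m, (A t h m).toReal * gap p μ m
            + ∑ m, (A t h m).toReal * gap p μ' m := by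
          rw [← Finset.sum_add_distrib]
          calc Δ = ∑ m, (A t h m).toReal * Δ := by rw [← Finset.sum_mul, sum_toReal, one_mul]
            _ ≤ _ := Finset.sum_le_sum fun m _ => by
              rw [← mul_add]
              exact mul_le_mul_of_nonneg_left (hΔ m) ENNReal.toReal_nonneg
        calc _ ≤ min (historyLaw p μ A t h).toReal (historyLaw p μ' A t h).toReal *
              (∑ m, (A t h m).toReal * gap p μ m + ∑ m, (A t h m).toReal * gap p μ' m) :=
              mul_le_mul_of_nonneg_left hs hmin
          _ ≤ _ := by
              rw [mul_add]
              exact add_le_add (mul_le_mul_of_nonneg_right (min_le_left _ _) (hnn μ t h))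
                (mul_le_mul_of_nonneg_right (min_le_right _ _) (hnn μ' t h))

/-! ### Optimal assignments for two arms -/

/-- The increment `g(n + 1) - g(n)`. -/
def dg (p : ℝ) (n : ℕ) : ℝ := g p (n + 1) - g p n

/-- Closed form of the increment, multiplied by `1 - p` to cover `n = 0`, where the exponent
`n - 1` in `g` is truncated. -/
lemma dg_mul (p : ℝ) (n : ℕ) : dg p n * (1 - p) = p * (1 - p) ^ n * (1 - (n + 1) * p) := by
  rcases n with _ | n
  · simp [dg, g]
  · simp only [dg, g, Nat.add_sub_cancel]
    push_cast
    ring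

/-- `g` is concave on the range of admissible numbers of players. -/
lemma dg_anti {p : ℝ} (hp0 : 0 < p) (hp1 : p < 1) {a b : ℕ} (hab : a ≤ b)
    (hb : (b + 1) * p ≤ 1) : dg p b ≤ dg p a := by
  have h1 : 0 < 1 - p := sub_pos.2 hp1
  refine le_of_mul_le_mul_right ?_ h1
  rw [dg_mul, dg_mul]
  have hab' : (a : ℝ) ≤ b := by exact_mod_cast hab
  refine mul_le_mul (mul_le_mul_of_nonneg_left
    (pow_le_pow_of_le_one h1.le (by linarith) hab) hp0.le) ?_ (by linarith) (by positivity)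
  nlinarith

lemma dg_pos {p : ℝ} (hp0 : 0 < p) (hp1 : p < 1) {b : ℕ} (hb : (b + 1) * p < 1) :
    0 < dg p b := by
  have h1 : 0 < 1 - p := sub_pos.2 hp1
  refine pos_of_mul_pos_left ?_ h1.le
  rw [dg_mul]
  have : 0 < 1 - (b + 1) * p := by linarith
  positivity

/-- The value of the assignment of `n` players to an arm of mean `u` and of the other
`2 N + 1 - n` players to an arm of mean `v`. -/
def splitValue (p : ℝ) (N : ℕ) (u v : ℝ) (n : ℕ) : ℝ := u * g p n + v * g p (2 * N + 1 - n)

lemma splitValue_succ_sub (p : ℝ) {N n : ℕ} (u v : ℝ) (hn : n ≤ 2 * N) :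
    splitValue p N u v (n + 1) - splitValue p N u v n = u * dg p n - v * dg p (2 * N - n) := by
  unfold splitValue dg
  rw [show 2 * N + 1 - (n + 1) = 2 * N - n by omega,
    show 2 * N + 1 - n = 2 * N - n + 1 by omega]
  ring

section Concave

variable {p : ℝ} {N : ℕ} {u v : ℝ}

lemma dg_le_of_le (hp0 : 0 < p) (hp : (2 * N + 2) * p ≤ 1) {a b : ℕ} (hab : a ≤ b)
    (hb : b ≤ 2 * N) : dg p b ≤ dg p a := by
  have hN : (0 : ℝ) ≤ N := N.cast_nonneg
  have hb' : (b : ℝ) ≤ 2 * N := by exact_mod_cast hb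
  exact dg_anti hp0 (by nlinarith) hab (by nlinarith)

lemma splitValue_up (hp0 : 0 < p) (hp : (2 * N + 2) * p ≤ 1) (hv : 0 ≤ v) (hvu : v ≤ u)
    {n : ℕ} (hn : n ≤ N) :
    (u - v) * dg p N ≤ splitValue p N u v (n + 1) - splitValue p N u v n := by
  rw [splitValue_succ_sub p u v (by omega)]
  have h1 := mul_le_mul_of_nonneg_left
    (dg_le_of_le hp0 hp hn (by omega)) (hv.trans hvu)
  have h2 := mul_le_mul_of_nonneg_left
    (dg_le_of_le hp0 hp (show N ≤ 2 * N - n by omega) (by omega)) hv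
  linarith

lemma splitValue_down (hp0 : 0 < p) (hp : (2 * N + 2) * p ≤ 1) (hv : 0 ≤ v) (hu : 0 ≤ u)
    {n : ℕ} (hn : N + 1 ≤ n) (hn' : n ≤ 2 * N) :
    v * dg p (N - 1) - u * dg p (N + 1) ≤ splitValue p N u v n - splitValue p N u v (n + 1) := by
  have h := splitValue_succ_sub p u v hn'
  have h1 := mul_le_mul_of_nonneg_left (dg_le_of_le hp0 hp hn hn') hu
  have h2 := mul_le_mul_of_nonneg_left
    (dg_le_of_le hp0 hp (show 2 * N - n ≤ N - 1 by omega) (by omega)) hv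
  linarith

/-- An assignment of at most `N` players to the better arm loses at least as much as the
mirror image of the optimal one. -/
lemma splitValue_gap_left (hp0 : 0 < p) (hp : (2 * N + 2) * p ≤ 1) (hd : 0 ≤ dg p N)
    (hv : 0 ≤ v) (hvu : v ≤ u) {n : ℕ} (hn : n ≤ N) :
    (u - v) * dg p N ≤ splitValue p N u v (N + 1) - splitValue p N u v n := by
  have key : ∀ b, n ≤ b → b ≤ N → splitValue p N u v n ≤ splitValue p N u v b := by
    intro b hb
    induction b, hb using Nat.le_induction with
    | base => exact fun _ => le_rfl
    | succ b hb ih =>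
      intro hbN
      have h1 := splitValue_up hp0 hp hv hvu (show b ≤ N by omega)
      have h2 := mul_nonneg (sub_nonneg.2 hvu) hd
      linarith [ih (by omega)]
  linarith [key N hn le_rfl, splitValue_up hp0 hp hv hvu (le_refl N)]

lemma splitValue_gap_right (hp0 : 0 < p) (hp : (2 * N + 2) * p ≤ 1) (hv : 0 ≤ v) (hu : 0 ≤ u)
    (huv : u * dg p (N + 1) ≤ v * dg p (N - 1)) {n : ℕ} (hn : N + 1 < n) (hn' : n ≤ 2 * N + 1) :
    v * dg p (N - 1) - u * dg p (N + 1) ≤ splitValue p N u v (N + 1) - splitValue p N u v n := by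
  induction n, hn using Nat.le_induction with
  | base => exact splitValue_down hp0 hp hv hu le_rfl (by omega)
  | succ b hb ih =>
    have h1 := splitValue_down hp0 hp hv hu (show N + 1 ≤ b by omega) (by omega)
    linarith [ih (by omega)]

/-- Adding one more player to the better arm does not pay as long as the means differ by less
than a fraction of order `p`. -/
lemma mul_dg_lt_mul_dg (hp0 : 0 < p) (hp : (2 * N + 2) * p ≤ 1) (hN : 1 ≤ N)
    (hv : 1 / 2 - p / 6 ≤ v) (hu0 : 0 ≤ u) (hu : u ≤ 1 / 2 + p / 6) :
    u * dg p (N + 1) < v * dg p (N - 1) := by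
  have hN' : (1 : ℝ) ≤ N := by exact_mod_cast hN
  have hp1 : p < 1 := by nlinarith
  have h1 : 0 < 1 - p := sub_pos.2 hp1
  have hv0 : 0 < v := by linarith
  -- Multiplying by `1 - p` puts `dg_mul` to use.
  refine lt_of_mul_lt_mul_right ?_ h1.le
  rw [mul_assoc, mul_assoc, dg_mul, dg_mul]
  have hcast : ((N - 1 : ℕ) : ℝ) + 1 = N := by
    rw [Nat.cast_sub hN]; simp
  rw [hcast]
  have hpow : (1 - p) ^ (N + 1) ≤ (1 - p) ^ (N - 1) :=
    pow_le_pow_of_le_one h1.le (by linarith) (by omega)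
  have hq : 0 < (1 - p) ^ (N - 1) := pow_pos h1 _
  have hnp : 0 ≤ 1 - ((N : ℝ) + 2) * p := by nlinarith
  have hmain : u * (1 - ((N : ℝ) + 2) * p) < v * (1 - N * p) := by
    have a1 : u * (1 - ((N : ℝ) + 2) * p) ≤ (1 / 2 + p / 6) * (1 - ((N : ℝ) + 2) * p) :=
      mul_le_mul_of_nonneg_right hu hnp
    have a2 : (1 / 2 - p / 6) * (1 - N * p) ≤ v * (1 - N * p) :=
      mul_le_mul_of_nonneg_right hv (by linarith)
    nlinarith [mul_pos hp0 hp0, mul_nonneg (mul_nonneg hp0.le hp0.le) (by linarith : (0 : ℝ) ≤ N)]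
  push_cast
  calc u * (p * (1 - p) ^ (N + 1) * (1 - ((N : ℝ) + 1 + 1) * p))
      = (p * (u * (1 - ((N : ℝ) + 2) * p))) * (1 - p) ^ (N + 1) := by ring
    _ ≤ (p * (u * (1 - ((N : ℝ) + 2) * p))) * (1 - p) ^ (N - 1) :=
        mul_le_mul_of_nonneg_left hpow (mul_nonneg hp0.le (mul_nonneg hu0 hnp))
    _ < (p * (v * (1 - N * p))) * (1 - p) ^ (N - 1) :=
        mul_lt_mul_of_pos_right (mul_lt_mul_of_pos_left hmain hp0) hq
    _ = _ := by ring

end Concave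

/-- All assignments are valid if `p ≤ 1 / (M + 1)`. -/
lemma le_neg_one_div_log {p x : ℝ} (hp0 : 0 < p) (hp : (x + 1) * p ≤ 1) (hx : 0 < x) :
    x ≤ -1 / Real.log (1 - p) := by
  have hp1 : p < 1 := by nlinarith
  have h1 : 0 < 1 - p := sub_pos.2 hp1
  have hlog : Real.log (1 - p) < 0 := Real.log_neg h1 (by linarith)
  have h := Real.one_sub_inv_le_log_of_pos h1
  rw [le_div_iff_of_neg hlog]
  have h2 : x * (1 - (1 - p)⁻¹) ≤ x * Real.log (1 - p) := mul_le_mul_of_nonneg_left h hx.le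
  refine le_trans ?_ h2
  have h3 : x * (1 - (1 - p)⁻¹) = -(x * p / (1 - p)) := by field_simp; ring
  rw [h3, neg_le_neg_iff, div_le_one h1]
  linarith

section Assignments

variable {N : ℕ} {p : ℝ}

/-- The assignment of `N + 1` of the `2 N + 1` players to arm `i` and of `N` to the other arm. -/
def majority (hp0 : 0 < p) (hp : (2 * N + 2) * p ≤ 1) (i : Fin 2) : Assignment (2 * N + 1) 2 p :=
  ⟨fun k => if k = i then ⟨N + 1, by omega⟩ else ⟨N, by omega⟩, by
    fin_cases i <;> simp <;> omega, fun k => by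
    refine le_trans ?_ (le_neg_one_div_log (x := 2 * N + 1) hp0 (by linarith) (by positivity))
    have hN : (0 : ℝ) ≤ N := N.cast_nonneg
    by_cases h : k = i <;> simp [h] <;> linarith⟩

lemma majority_self (hp0 : 0 < p) (hp : (2 * N + 2) * p ≤ 1) (i : Fin 2) :
    ((majority hp0 hp i).1 i : ℕ) = N + 1 := by simp [majority]

lemma majority_other (hp0 : 0 < p) (hp : (2 * N + 2) * p ≤ 1) {i k : Fin 2} (h : k ≠ i) :
    ((majority hp0 hp i).1 k : ℕ) = N := by simp [majority, h]

lemma sum_eq_add_of_ne {α : Type*} [AddCommMonoid α] {i j : Fin 2} (hij : i ≠ j) (f : Fin 2 → α) :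
    ∑ k, f k = f i + f j := by
  rw [show (Finset.univ : Finset (Fin 2)) = {i, j} by revert i j; decide, Finset.sum_pair hij]

lemma Assignment.add_eq (m : Assignment (2 * N + 1) 2 p) {i j : Fin 2} (hij : i ≠ j) :
    (m.1 i : ℕ) + m.1 j = 2 * N + 1 :=
  (sum_eq_add_of_ne hij fun k => (m.1 k : ℕ)).symm.trans m.2.1

lemma value_eq_splitValue (m : Assignment (2 * N + 1) 2 p) {i j : Fin 2} (hij : i ≠ j)
    (μ : Fin 2 → ℝ) : value μ m = splitValue p N (μ i) (μ j) (m.1 i) := by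
  have h := m.add_eq hij
  rw [value, sum_eq_add_of_ne hij, splitValue,
    show 2 * N + 1 - (m.1 i : ℕ) = m.1 j by omega]

lemma eq_majority (hp0 : 0 < p) (hp : (2 * N + 2) * p ≤ 1) {i : Fin 2}
    {m : Assignment (2 * N + 1) 2 p} (h : (m.1 i : ℕ) = N + 1) : m = majority hp0 hp i := by
  refine Subtype.ext (funext fun k => Fin.ext ?_)
  by_cases hk : k = i
  · rw [hk, h, majority_self]
  · rw [majority_other hp0 hp hk]
    have := m.add_eq hk
    omega

lemma emptyArms_majority (hp0 : 0 < p) (hp : (2 * N + 2) * p ≤ 1) (hN : 1 ≤ N) (i : Fin 2) :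
    emptyArms (majority hp0 hp i) = 0 := by
  rw [emptyArms, Finset.card_eq_zero, Finset.filter_eq_empty_iff]
  intro k _
  by_cases hk : k = i
  · rw [hk, majority_self]; omega
  · rw [majority_other hp0 hp hk]; omega

lemma half_dg_pos (hp0 : 0 < p) (hp : (2 * N + 2) * p ≤ 1) : 0 < dg p N := by
  have hN : (0 : ℝ) ≤ N := N.cast_nonneg
  exact dg_pos hp0 (by nlinarith) (by nlinarith)

lemma value_le_majority (hp0 : 0 < p) (hp : (2 * N + 2) * p ≤ 1) (hN : 1 ≤ N)
    {i j : Fin 2} (hij : i ≠ j) {μ : Fin 2 → ℝ} (hμj : 1 / 2 - p / 6 ≤ μ j)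
    (hji : μ j ≤ μ i) (hμi : μ i ≤ 1 / 2 + p / 6) (m : Assignment (2 * N + 1) 2 p) :
    value μ m ≤ value μ (majority hp0 hp i) := by
  have hN' : (1 : ℝ) ≤ N := by exact_mod_cast hN
  have hp1 : p < 1 := by nlinarith
  have hd := (half_dg_pos hp0 hp).le
  rw [value_eq_splitValue m hij, value_eq_splitValue _ hij, majority_self]
  have hlt := mul_dg_lt_mul_dg hp0 hp hN hμj (by linarith) hμi
  rcases lt_trichotomy (m.1 i : ℕ) (N + 1) with h | h | h
  · have := splitValue_gap_left hp0 hp hd (by linarith) hji (Nat.lt_succ_iff.1 h)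
    have := mul_nonneg (sub_nonneg.2 hji) hd
    linarith
  · rw [h]
  · have := splitValue_gap_right hp0 hp (by linarith) (by linarith) hlt.le h
      (Nat.lt_succ_iff.1 (m.1 i).2)
    linarith

lemma value_lt_majority (hp0 : 0 < p) (hp : (2 * N + 2) * p ≤ 1) (hN : 1 ≤ N)
    {i j : Fin 2} (hij : i ≠ j) {μ : Fin 2 → ℝ} (hμj : 1 / 2 - p / 6 ≤ μ j)
    (hji : μ j < μ i) (hμi : μ i ≤ 1 / 2 + p / 6) {m : Assignment (2 * N + 1) 2 p}
    (hm : m ≠ majority hp0 hp i) :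
    value μ m < value μ (majority hp0 hp i) := by
  have hN' : (1 : ℝ) ≤ N := by exact_mod_cast hN
  have hp1 : p < 1 := by nlinarith
  have hd := half_dg_pos hp0 hp
  have hm' : (m.1 i : ℕ) ≠ N + 1 := fun h => hm (eq_majority hp0 hp h)
  rw [value_eq_splitValue m hij, value_eq_splitValue _ hij, majority_self]
  have hlt := mul_dg_lt_mul_dg hp0 hp hN hμj (by linarith) hμi
  rcases lt_or_gt_of_ne hm' with h | h
  · have := splitValue_gap_left hp0 hp hd.le (by linarith) hji.le (Nat.lt_succ_iff.1 h)
    have := mul_pos (sub_pos.2 hji) hd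
    linarith
  · have := splitValue_gap_right hp0 hp (by linarith) (by linarith) hlt.le h
      (Nat.lt_succ_iff.1 (m.1 i).2)
    linarith

lemma maximizers_eq_majority (hp0 : 0 < p) (hp : (2 * N + 2) * p ≤ 1) (hN : 1 ≤ N)
    {i j : Fin 2} (hij : i ≠ j) {μ : Fin 2 → ℝ} (hμj : 1 / 2 - p / 6 ≤ μ j)
    (hji : μ j < μ i) (hμi : μ i ≤ 1 / 2 + p / 6) {S : Set (Assignment (2 * N + 1) 2 p)}
    (hS : majority hp0 hp i ∈ S) : maximizers S μ = {majority hp0 hp i} := by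
  ext m
  simp only [maximizers, Set.mem_ofPred_eq, Set.mem_singleton_iff]
  constructor
  · rintro ⟨_, h⟩
    by_contra hm
    exact absurd (h _ hS) (not_le.2 (value_lt_majority hp0 hp hN hij hμj hji hμi hm))
  · rintro rfl
    exact ⟨hS, fun m' _ => value_le_majority hp0 hp hN hij hμj hji.le hμi m'⟩

/-! ### The hard instances: optimum and stability radius -/

/-- The means `1/2 + r₀` of arm `i` and `1/2 - r₀` of the other arm. -/
def hardMeans (r₀ : ℝ) (i : Fin 2) : Fin 2 → ℝ := fun k => if k = i then 1 / 2 + r₀ else 1 / 2 - r₀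

lemma hardMeans_self (r₀ : ℝ) (i : Fin 2) : hardMeans r₀ i i = 1 / 2 + r₀ := if_pos rfl

lemma hardMeans_other (r₀ : ℝ) {i j : Fin 2} (hij : i ≠ j) : hardMeans r₀ i j = 1 / 2 - r₀ :=
  if_neg hij.symm

lemma nuStar_hardMeans (hp0 : 0 < p) (hp : (2 * N + 2) * p ≤ 1) (hN : 1 ≤ N) {r₀ : ℝ}
    (hr₀ : 0 < r₀) (hr₀p : r₀ < p / 12) {i j : Fin 2} (hij : i ≠ j) :
    nuStar (2 * N + 1) p (hardMeans r₀ i) = 0 := by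
  have h := maximizers_eq_majority hp0 hp hN hij (μ := hardMeans r₀ i)
    (by rw [hardMeans_other r₀ hij]; linarith)
    (by rw [hardMeans_other r₀ hij, hardMeans_self]; linarith)
    (by rw [hardMeans_self]; linarith) (Set.mem_univ _)
  simp [nuStar, h, emptyArms_majority hp0 hp hN]

/-- The nearest change of the optimum is the tie at the means `(1/2, 1/2)`. -/
lemma rNu_hardMeans (hp0 : 0 < p) (hp : (2 * N + 2) * p ≤ 1) (hN : 1 ≤ N) {r₀ : ℝ}
    (hr₀ : 0 < r₀) (hr₀p : r₀ < p / 12) {i j : Fin 2} (hij : i ≠ j) :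
    rNu (2 * N + 1) p (hardMeans r₀ i) 0 = r₀ := by
  have hS : ∀ k, majority hp0 hp k ∈ atMostEmpty (2 * N + 1) 2 p 0 := fun k =>
    (emptyArms_majority hp0 hp hN k).le
  have h := maximizers_eq_majority hp0 hp hN hij (μ := hardMeans r₀ i)
    (by rw [hardMeans_other r₀ hij]; linarith)
    (by rw [hardMeans_other r₀ hij, hardMeans_self]; linarith)
    (by rw [hardMeans_self]; linarith) (hS i)
  have hne : majority hp0 hp j ≠ majority hp0 hp i := fun he => by
    have := majority_self hp0 hp j
    rw [he, majority_other hp0 hp hij.symm] at this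
    omega
  refine IsLeast.csInf_eq ⟨?_, ?_⟩
  · refine ⟨majority hp0 hp i, h ▸ rfl, fun _ => 1 / 2, majority hp0 hp j, ⟨hS j, fun m _ => ?_⟩,
      hne, ?_⟩
    · exact value_le_majority hp0 hp hN hij.symm (by linarith) le_rfl (by linarith) m
    · have habs : ∀ k, ‖((fun _ => 1 / 2) - hardMeans r₀ i : Fin 2 → ℝ) k‖ = r₀ := fun k => by
        by_cases hk : k = i <;> simp [hardMeans, hk, abs_of_pos hr₀]
      refine le_antisymm ?_ ?_
      · exact (habs i).symm.le.trans (norm_le_pi_norm _ i)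
      · exact (pi_norm_le_iff_of_nonneg hr₀.le).2 fun k => (habs k).le
  -- Closer than `r₀`, the mean of arm `i` stays above `1/2` and the other one below.
  · rintro d ⟨m, hm, μ', m', hm', hmm, rfl⟩
    rw [h, Set.mem_singleton_iff] at hm
    by_contra hlt
    rw [not_le] at hlt
    have hi := (norm_le_pi_norm (μ' - hardMeans r₀ i) i).trans_lt hlt
    have hj := (norm_le_pi_norm (μ' - hardMeans r₀ i) j).trans_lt hlt
    rw [Pi.sub_apply, Real.norm_eq_abs, abs_lt, hardMeans_self] at hi
    rw [Pi.sub_apply, Real.norm_eq_abs, abs_lt, hardMeans_other r₀ hij] at hj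
    have h' := maximizers_eq_majority hp0 hp hN hij (μ := μ') (by linarith) (by linarith)
      (by linarith) (hS i)
    rw [h', Set.mem_singleton_iff] at hm'
    exact hmm (hm'.trans hm.symm)

lemma r_hardMeans (hp0 : 0 < p) (hp : (2 * N + 2) * p ≤ 1) (hN : 1 ≤ N) {r₀ : ℝ}
    (hr₀ : 0 < r₀) (hr₀p : r₀ < p / 12) {i j : Fin 2} (hij : i ≠ j) :
    r (2 * N + 1) p (hardMeans r₀ i) = r₀ := by
  rw [r, nuStar_hardMeans hp0 hp hN hr₀ hr₀p hij]
  change (⨅ ν : Fin 1, rNu (2 * N + 1) p (hardMeans r₀ i) ν) = r₀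
  rw [ciInf_unique]
  exact rNu_hardMeans hp0 hp hN hr₀ hr₀p hij

end Assignments

/-! ### Regret on the hard instances -/

section HardInstances

variable {N : ℕ} {p : unitInterval} {r₀ : ℝ}

/-- `hardMeans` as an instance of the bandit problem. -/
def hardInstance (hr₀ : 0 < r₀) (hr₀1 : r₀ ≤ 1 / 2) (i : Fin 2) : Fin 2 → unitInterval := fun k =>
  ⟨hardMeans r₀ i k, by unfold hardMeans; split_ifs <;> constructor <;> linarith⟩

lemma le_gap_of_le_half (hp0 : 0 < (p : ℝ)) (hp : (2 * N + 2) * (p : ℝ) ≤ 1) (hr₀ : 0 < r₀)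
    (hr₀1 : r₀ ≤ 1 / 2) {i j : Fin 2} (hij : i ≠ j) {m : Assignment (2 * N + 1) 2 p}
    (hm : (m.1 i : ℕ) ≤ N) : 2 * r₀ * dg p N ≤ gap p (hardInstance hr₀ hr₀1 i) m := by
  have h1 := le_ciSup (Set.finite_range (meanReward p (hardInstance hr₀ hr₀1 i))).bddAbove
    (majority hp0 hp i)
  have h2 := splitValue_gap_left hp0 hp (half_dg_pos hp0 hp).le
    (show 0 ≤ 1 / 2 - r₀ by linarith) (show 1 / 2 - r₀ ≤ 1 / 2 + r₀ by linarith) hm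
  have hv : ∀ m' : Assignment (2 * N + 1) 2 p, meanReward p (hardInstance hr₀ hr₀1 i) m'
      = splitValue p N (1 / 2 + r₀) (1 / 2 - r₀) (m'.1 i) := fun m' => by
    rw [meanReward_eq_value (by omega), value_eq_splitValue m' hij]
    simp only [hardInstance, hardMeans_self, hardMeans_other r₀ hij]
  rw [hv, majority_self] at h1
  rw [gap, hv]
  linarith

/-- No assignment puts most players on both arms. -/
lemma le_gap_add_gap (hp0 : 0 < (p : ℝ)) (hp : (2 * N + 2) * (p : ℝ) ≤ 1) (hr₀ : 0 < r₀)
    (hr₀1 : r₀ ≤ 1 / 2) (m : Assignment (2 * N + 1) 2 p) :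
    2 * r₀ * dg p N ≤ gap p (hardInstance hr₀ hr₀1 0) m + gap p (hardInstance hr₀ hr₀1 1) m := by
  have hm := m.add_eq (zero_ne_one : (0 : Fin 2) ≠ 1)
  rcases le_or_gt (m.1 0 : ℕ) N with h | h
  · exact (le_gap_of_le_half hp0 hp hr₀ hr₀1 zero_ne_one h).trans
      (le_add_of_nonneg_right (gap_nonneg _ _ _))
  · exact (le_gap_of_le_half hp0 hp hr₀ hr₀1 one_ne_zero (by omega)).trans
      (le_add_of_nonneg_left (gap_nonneg _ _ _))

/-- One round hardly distinguishes the two hard instances: `1 - √(1 - 4 r₀²)`, the loss of affinity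
on an arm with `η = 1`, is at most `(8/3) r₀²`, and `η = 1` has probability at most `n p`. -/
lemma affinity_obsLaw_hardInstance (hp : (2 * N + 2) * (p : ℝ) ≤ 1) (hr₀ : 0 < r₀)
    (hr₀1 : r₀ ≤ 1 / 4) (m : Assignment (2 * N + 1) 2 p) :
    1 - (2 * N + 1) * (p : ℝ) * (8 / 3 * r₀ ^ 2) ≤
      affinity (obsLaw p (hardInstance hr₀ (by linarith) 0) m)
        (obsLaw p (hardInstance hr₀ (by linarith) 1) m) := by
  have hp0 := p.2.1
  have hm : (((m.1 0 : ℕ) : ℝ) + ((m.1 1 : ℕ) : ℝ)) = 2 * N + 1 := by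
    exact_mod_cast m.add_eq (zero_ne_one : (0 : Fin 2) ≠ 1)
  have hle : ∀ k, (m.1 k : ℕ) ≤ 2 * N + 1 := fun k => Nat.lt_succ_iff.1 (m.1 k).2
  have hsq : 1 / 2 - 4 / 3 * r₀ ^ 2 ≤ √((1 / 2 + r₀) * (1 / 2 - r₀)) := by
    apply Real.le_sqrt_of_sq_le
    have : r₀ ^ 2 ≤ 1 / 16 := by nlinarith
    nlinarith [sq_nonneg r₀]
  rw [obsLaw, obsLaw, affinity_indepPMF, Fin.prod_univ_two,
    affinity_armLaw (by omega) (hle 0), affinity_armLaw (by omega) (hle 1)]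
  have e0 : 1 - (√((hardInstance hr₀ (by linarith) 0 0 : ℝ) * hardInstance hr₀ (by linarith) 1 0)
      + √((1 - hardInstance hr₀ (by linarith) 0 0 : ℝ) * (1 - hardInstance hr₀ (by linarith) 1 0)))
      ≤ 8 / 3 * r₀ ^ 2 := by
    simp only [hardInstance, hardMeans_self, hardMeans_other r₀ (one_ne_zero : (1 : Fin 2) ≠ 0)]
    rw [show (1 - (1 / 2 + r₀)) * (1 - (1 / 2 - r₀)) = (1 / 2 + r₀) * (1 / 2 - r₀) by ring]
    linarith
  have e1 : 1 - (√((hardInstance hr₀ (by linarith) 0 1 : ℝ) * hardInstance hr₀ (by linarith) 1 1)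
      + √((1 - hardInstance hr₀ (by linarith) 0 1 : ℝ) * (1 - hardInstance hr₀ (by linarith) 1 1)))
      ≤ 8 / 3 * r₀ ^ 2 := by
    simp only [hardInstance, hardMeans_self, hardMeans_other r₀ (zero_ne_one : (0 : Fin 2) ≠ 1)]
    rw [show (1 - (1 / 2 - r₀)) * (1 - (1 / 2 + r₀)) = (1 / 2 + r₀) * (1 / 2 - r₀) by ring,
      show (1 / 2 - r₀) * (1 / 2 + r₀) = (1 / 2 + r₀) * (1 / 2 - r₀) by ring]
    linarith
  set δ := 8 / 3 * r₀ ^ 2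
  have hδ0 : 0 ≤ δ := by positivity
  have hδ1 : δ ≤ 1 := by simp only [δ]; nlinarith
  have g0 := g_nonneg p (m.1 0)
  have g1 := g_nonneg p (m.1 1)
  have hg : g p (m.1 0) + g p (m.1 1) ≤ (2 * N + 1) * p := by
    rw [← hm, add_mul]
    exact add_le_add (g_le p _) (g_le p _)
  have b0 := mul_le_mul_of_nonneg_left e0 g0
  have b1 := mul_le_mul_of_nonneg_left e1 g1
  have hd0 : 0 ≤ g p (m.1 0) * δ := mul_nonneg g0 hδ0
  have hd1 : 0 ≤ g p (m.1 1) * δ := mul_nonneg g1 hδ0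
  have c0 : g p (m.1 0) * δ ≤ 1 := mul_le_one₀ (by linarith) hδ0 hδ1
  have c1 : g p (m.1 1) * δ ≤ 1 := mul_le_one₀ (by linarith) hδ0 hδ1
  calc 1 - (2 * N + 1) * (p : ℝ) * δ ≤ 1 - (g p (m.1 0) + g p (m.1 1)) * δ :=
        sub_le_sub_left (mul_le_mul_of_nonneg_right hg hδ0) _
    _ ≤ (1 - g p (m.1 0) * δ) * (1 - g p (m.1 1) * δ) := by nlinarith [mul_nonneg hd0 hd1]
    _ ≤ _ := mul_le_mul (by linarith) (by linarith) (by linarith) (by linarith)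

end HardInstances

/-- Summing a bound that decays linearly over `⌈L⌉` rounds. -/
lemma le_sum_one_sub_mul {a L : ℝ} (ha : 0 ≤ a) (hL : 0 ≤ L) (haL : a * L ≤ 2 / 3) :
    L / 3 ≤ ∑ t ∈ Finset.range ⌈L⌉₊, (1 - 2 * (t : ℝ) * a) := by
  have hsum : ∀ n : ℕ, ∑ t ∈ Finset.range n, (1 - 2 * (t : ℝ) * a)
      = n * (1 - a * (n - 1)) := fun n => by
    induction n with
    | zero => simp
    | succ n ih => rw [Finset.sum_range_succ, ih]; push_cast; ring
  rw [hsum]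
  have h1 := Nat.le_ceil L
  have h2 := Nat.ceil_lt_add_one hL
  have h3 : a * ((⌈L⌉₊ : ℝ) - 1) ≤ a * L := mul_le_mul_of_nonneg_left (by linarith) ha
  calc L / 3 = L * (1 / 3) := by ring
    _ ≤ _ := mul_le_mul h1 (by linarith) (by norm_num) (by linarith)

/-- The increment of `g` at half of the players is at least of the order of `g(M) / M`. -/
lemma g_le_mul_dg {N : ℕ} {p : ℝ} (hp0 : 0 < p) (hp : (2 * N + 2) * p ≤ 1) :
    3 * g p (2 * N + 1) ≤ 8 * (2 * N + 1) * dg p N := by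
  have hN : (0 : ℝ) ≤ N := N.cast_nonneg
  have h1 : 0 < 1 - p := by nlinarith
  have hd := half_dg_pos hp0 hp
  have hpow : (1 - p) ^ (2 * N) ≤ (1 - p) ^ N :=
    pow_le_pow_of_le_one h1.le (by linarith) (by omega)
  have hq : 0 < (1 - p) ^ N := pow_pos h1 _
  have hdg : p * (1 - p) ^ N / 2 ≤ dg p N := by
    have e := dg_mul p N
    have : p * (1 - p) ^ N * (1 / 2) ≤ p * (1 - p) ^ N * (1 - (N + 1) * p) :=
      mul_le_mul_of_nonneg_left (by linarith) (by positivity)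
    nlinarith
  have hg : g p (2 * N + 1) ≤ (2 * N + 1) * (p * (1 - p) ^ N) := by
    simp only [g, Nat.add_sub_cancel]
    push_cast
    rw [← mul_assoc]
    exact mul_le_mul_of_nonneg_left hpow (by positivity)
  have hk : 0 ≤ (2 * N + 1) * (p * (1 - p) ^ N) := by positivity
  have := mul_le_mul_of_nonneg_left hdg (show 0 ≤ 8 * (2 * (N : ℝ) + 1) by positivity)
  nlinarith

lemma mul_le_four_mul_g {N : ℕ} {p : ℝ} (hp0 : 0 < p) (hp : (2 * N + 2) * p ≤ 1) :
    (2 * N + 1) * p ≤ 4 * g p (2 * N + 1) := by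
  have hN : (0 : ℝ) ≤ N := N.cast_nonneg
  have h1 : 0 < 1 - p := by nlinarith
  have hb := one_add_mul_le_pow (show (-2 : ℝ) ≤ -p by linarith) N
  -- Bernoulli's inequality and `N p ≤ 1 / 2`.
  have hhalf : 1 / 2 ≤ (1 - p) ^ N := by
    rw [sub_eq_add_neg]
    linarith
  have hquart : 1 / 4 ≤ (1 - p) ^ (2 * N) := by
    rw [mul_comm 2 N, pow_mul]
    nlinarith
  simp only [g, Nat.add_sub_cancel]
  push_cast
  have := mul_le_mul_of_nonneg_left hquart (show 0 ≤ (2 * (N : ℝ) + 1) * p by positivity)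
  linarith

/-- The two hard instances cannot both have small regret. Only the first `⌈L⌉` rounds are used,
where `L = 1 / (16 g(M) r₀²)`; by then the histories are still hard to tell apart. -/
lemma expectedRegret_add_hardInstance {N : ℕ} {p : unitInterval} {r₀ : ℝ} (hp0 : 0 < (p : ℝ))
    (hp : (2 * N + 2) * (p : ℝ) ≤ 1) (hr₀ : 0 < r₀) (hr₀1 : r₀ ≤ 1 / 4) {T : ℕ}
    (hT : 1 / (16 * g p (2 * N + 1) * r₀ ^ 2) ≤ (T : ℝ)) (A : Algorithm (2 * N + 1) 2 p) :
    2 * (1 / (256 * (2 * N + 1) * r₀)) ≤ expectedRegret p (hardInstance hr₀ (by linarith) 0) A T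
      + expectedRegret p (hardInstance hr₀ (by linarith) 1) A T := by
  have hN : (0 : ℝ) ≤ N := N.cast_nonneg
  have hd := half_dg_pos hp0 hp
  have h4 := mul_le_four_mul_g hp0 hp
  have hg : 0 < g p (2 * N + 1) := by
    have : 0 < (2 * (N : ℝ) + 1) * p := by positivity
    linarith
  set L := 1 / (16 * g p (2 * N + 1) * r₀ ^ 2) with hLdef
  set a := (2 * N + 1) * (p : ℝ) * (8 / 3 * r₀ ^ 2) with hadef
  have hL : 0 < L := by positivity
  have ha0 : 0 ≤ a := by positivity
  have ha1 : a ≤ 1 := mul_le_one₀ (by linarith) (by positivity) (by nlinarith)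
  have haL : a * L ≤ 2 / 3 := by
    have : a * L = (2 * N + 1) * p / (6 * g p (2 * N + 1)) := by
      rw [hadef, hLdef]; field_simp; norm_num
    rw [this, div_le_iff₀ (by positivity)]
    linarith
  have haff := fun t : ℕ => pow_le_affinity_historyLaw p (hardInstance hr₀ (by linarith) 0)
    (hardInstance hr₀ (by linarith) 1) A (sub_nonneg.2 ha1)
    (affinity_obsLaw_hardInstance hp hr₀ hr₀1) t
  have hsum : L / 3 ≤ ∑ t ∈ Finset.range ⌈L⌉₊,
      affinity (historyLaw p (hardInstance hr₀ (by linarith) 0) A t)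
        (historyLaw p (hardInstance hr₀ (by linarith) 1) A t) ^ 2 := by
    refine (le_sum_one_sub_mul ha0 hL.le haL).trans (Finset.sum_le_sum fun t _ => ?_)
    have hb := one_add_mul_le_pow (show (-2 : ℝ) ≤ -a by linarith) (2 * t)
    rw [← sub_eq_add_neg, mul_comm 2 t, pow_mul] at hb
    push_cast at hb
    have := pow_le_pow_left₀ (pow_nonneg (sub_nonneg.2 ha1) t) (haff t) 2
    linarith
  have hmain := le_expectedRegret_add p _ _ A (le_gap_add_gap hp0 hp hr₀ (by linarith))
    (by positivity) (Nat.ceil_le.2 hT)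
  refine le_trans ?_ hmain
  refine le_trans ?_ (mul_le_mul_of_nonneg_left hsum (by positivity))
  have e : 2 * r₀ * dg p N / 2 * (L / 3) = dg p N / (48 * g p (2 * N + 1) * r₀) := by
    rw [hLdef]; field_simp; norm_num
  rw [e, ← mul_div_assoc, div_le_div_iff₀ (by positivity) (by positivity)]
  nlinarith [mul_le_mul_of_nonneg_right (g_le_mul_dg hp0 hp) hr₀.le]

end

end AMMAB

theorem mainTheorem2 (M N : ℕ) (hN : 1 ≤ N) (hM : M = 2 * N + 1)
    (p : unitInterval) (hp : (p : ℝ) ≤ 1 / ((M : ℝ) + 1))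
    (r₀ : ℝ) (hr₀ : 0 < r₀) (hr₀p : r₀ < (p : ℝ) / 12)
    (T : ℕ) (hT : 1 / (16 * AMMAB.g p M * r₀ ^ 2) ≤ (T : ℝ))
    (A : AMMAB.Algorithm M 2 p) :
    ∃ μ : Fin 2 → unitInterval,
      AMMAB.nuStar M p (fun k => (μ k : ℝ)) = 0 ∧
      AMMAB.r M p (fun k => (μ k : ℝ)) = r₀ ∧
      1 / (256 * (M : ℝ) * r₀) ≤ AMMAB.expectedRegret p μ A T := by
  subst hM
  have hp0 : 0 < (p : ℝ) := by linarith
  have hr₀1 : r₀ ≤ 1 / 4 := by linarith [p.2.2]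
  have hp' : (2 * N + 2) * (p : ℝ) ≤ 1 := by
    rw [le_div_iff₀ (by positivity)] at hp
    push_cast at hp
    linarith
  have hsum := AMMAB.expectedRegret_add_hardInstance hp0 hp' hr₀ hr₀1 hT A
  have hgood : ∀ i j : Fin 2, i ≠ j →
      1 / (256 * (2 * (N : ℝ) + 1) * r₀) ≤
        AMMAB.expectedRegret p (AMMAB.hardInstance hr₀ (by linarith) i) A T →
      ∃ μ : Fin 2 → unitInterval,
        AMMAB.nuStar (2 * N + 1) p (fun k => (μ k : ℝ)) = 0 ∧
        AMMAB.r (2 * N + 1) p (fun k => (μ k : ℝ)) = r₀ ∧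
        1 / (256 * ((2 * N + 1 : ℕ) : ℝ) * r₀) ≤ AMMAB.expectedRegret p μ A T :=
    fun i j hij h => ⟨AMMAB.hardInstance hr₀ (by linarith) i,
      AMMAB.nuStar_hardMeans hp0 hp' hN hr₀ hr₀p hij,
      AMMAB.r_hardMeans hp0 hp' hN hr₀ hr₀p hij, by push_cast; exact h⟩
  rcases le_or_gt (1 / (256 * (2 * (N : ℝ) + 1) * r₀))
    (AMMAB.expectedRegret p (AMMAB.hardInstance hr₀ (by linarith) 0) A T) with h | h
  · exact hgood 0 1 zero_ne_one h
  · exact hgood 1 0 one_ne_zero (by linarith)
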